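/- Let $X$ be a compact, second countable, Hausdorff, totally disconnected space and let $R$ be an equivalence relation on $X$ (identified with its graph in $X\times X$) such that $R=\bigcup_n R_n$, where $R_0\subset R_1\subset\cdots$ are proper equivalence relations, i.e. each $R_n$ is closed in $X\times X$ and the quotient map $X\to X/R_n$ is a local homeomorphism; thus $(X,R)$ is an AF equivalence relation. Equip $R$ with the inductive limit topology: $U\subset R$ is open iff $U\cap R_n$ is open in $R_n\subset X\times X$ for all $n$. Let $A$ be a locally compact Hausdorff group. A cocycle is a map $c:R\to A$ with $c(x,y)c(y,z)=c(x,z)$; two cocycles $c,c'$ are continuously cohomologous if $c'(x,y)=b(x)c(x,y)b(y)^{-1}$ on $R$ for some continuous $b:X\to A$. A Bratteli diagram consists of vertex sets $V(n)$ ($n\ge 0$) and sets $E(n)$ ($n\ge 1$) of edges running from a vertex of $V(n-1)$ to a vertex of $V(n)$, such that every vertex emits finitely many, but at least one, edges. Its path space $\underline X$ is the set of infinite paths $x=x_1x_2\ldots$ ($x_n\in E(n)$) starting at level $0$, with the topology generated by the cylinder sets. Its tail equivalence relation is $\underline R=\bigcup_N\underline R_N$, where $(x,y)\in\underline R_N$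 iff $x_n=y_n$ for all $n>N$; it has the inductive limit topology of the $\underline R_N$. A cocycle $c:\underline R\to A$ is a quasi-product cocycle if there are maps $f_n:E(n)\to A$ with $c(x,y)=\lim_n f_1(x_1)\cdots f_n(x_n)f_n(y_n)^{-1}\cdots f_1(y_1)^{-1}$ for all $(x,y)\in\underline R$ (the sequence is eventually constant). 1. There exist a Bratteli diagram with path space and tail equivalence relation $(\underline X,\underline R)$ and a homeomorphism $\varphi:X\to\underline X$ such that $\varphi\times\varphi$ maps $R$ onto $\underline R$ and is a homeomorphism for the inductive limit topologies. 2. If $c:R\to A$ is a continuous cocycle that takes finitely many values on each $R_n$, then the Bratteli diagram and $\varphi$ in (1) can be chosen such that the cocycle $c\circ(\varphi\times\varphi)^{-1}$ on $\underline R$ is a quasi-product cocycle. 3. If $A$ is metrizable, every continuous cocycle $c:R\to A$ is continuously cohomologous to a continuous cocycle that takes finitely many values on each $R_n$. Consequently, if $A$ is metrizable, every continuous cocycle $c:R\to A$ is continuously cohomologous to a continuous cocycle $c'$ for which there are a Bratteli diagram and a homeomorphism $\varphi$ as in (1) such that $c'\circ(\varphi\times\varphi)^{-1}$ is a quasi-product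 cocycle. -/

import Mathlib

universe u v

namespace AFRel

/-! ### Equivalence relations, proper relations, exhaustions -/

/-- The graph `{(x, y) : x R y} ⊆ X × X` of an equivalence relation. -/
abbrev Graph {X : Type u} (R : Setoid X) : Type u := {p : X × X // R p.1 p.2}

/-- `R` is proper: its graph is closed in `X × X` and the quotient map `X → X / R`
(quotient topology) is a local homeomorphism. -/
structure IsProper {X : Type u} [TopologicalSpace X] (R : Setoid X) : Prop where
  isClosed_graph : IsClosed {p : X × X | R p.1 p.2}
  isLocalHomeomorph_mk : IsLocalHomeomorph (Quotient.mk R)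

/-- An increasing sequence of equivalence relations with union `R`. -/
structure Exhaustion {X : Type u} (R : Setoid X) where
  rel : ℕ → Setoid X
  mono : Monotone rel
  union : ∀ x y, R x y ↔ ∃ n, rel n x y

namespace Exhaustion

variable {X : Type u} {R : Setoid X}

/-- The inclusion `R_n → R`. -/
def incl (𝓔 : Exhaustion R) (n : ℕ) (p : Graph (𝓔.rel n)) : Graph R :=
  ⟨p.1, (𝓔.union _ _).2 ⟨n, p.2⟩⟩

/-- The inductive limit topology on `R = ⋃ R_n`, where each `R_n` has the topology
of a subspace of `X × X`: a set is open iff its trace on every `R_n` is open. -/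
abbrev limTopology [TopologicalSpace X] (𝓔 : Exhaustion R) : TopologicalSpace (Graph R) :=
  ⨆ n, TopologicalSpace.coinduced (𝓔.incl n) instTopologicalSpaceSubtype

/-- `R`, as the union of the given sequence, is an AF equivalence relation: the relations `R_n` are
proper and `X` is totally disconnected. -/
structure IsAF [TopologicalSpace X] (𝓔 : Exhaustion R) : Prop where
  proper : ∀ n, IsProper (𝓔.rel n)
  totallyDisconnected : TotallyDisconnectedSpace X

end Exhaustion

/-! ### Cocycles -/

/-- `c : R → A` is a cocycle: `c(x,y) c(y,z) = c(x,z)`. -/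
def IsCocycle {X : Type u} (R : Setoid X) {A : Type v} [Group A] (c : Graph R → A) : Prop :=
  ∀ (x y z : X) (hxy : R x y) (hyz : R y z),
    c ⟨(x, y), hxy⟩ * c ⟨(y, z), hyz⟩ = c ⟨(x, z), R.trans hxy hyz⟩

/-- Continuous cocycles, with respect to the inductive limit topology of `R`. -/
structure IsContCocycle {X : Type u} [TopologicalSpace X] {R : Setoid X} (𝓔 : Exhaustion R)
    {A : Type v} [Group A] [TopologicalSpace A] (c : Graph R → A) : Prop where
  cocycle : IsCocycle R c
  continuous : @Continuous _ _ 𝓔.limTopology _ c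

/-- `c` takes finitely many values on each `R_n`. -/
def FinitelyValuedOnEach {X : Type u} {R : Setoid X} (𝓔 : Exhaustion R)
    {A : Type v} (c : Graph R → A) : Prop :=
  ∀ n, (Set.range fun p : Graph (𝓔.rel n) => c (𝓔.incl n p)).Finite

/-- `c` and `c'` are continuously cohomologous: `c'(x,y) = b(x) c(x,y) b(y)⁻¹` for some
continuous `b : X → A`. -/
def ContCohomologous {X : Type u} [TopologicalSpace X] {R : Setoid X}
    {A : Type v} [Group A] [TopologicalSpace A] (c c' : Graph R → A) : Prop :=
  ∃ b : X → A, Continuous b ∧ ∀ p : Graph R, c' p = b p.1.1 * c p * (b p.1.2)⁻¹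

/-! ### Isomorphisms -/

/-- `φ × φ` carries `R` onto `S`. -/
def Carries {X Y : Type u} (R : Setoid X) (S : Setoid Y) (φ : X ≃ Y) : Prop :=
  ∀ x y, R x y ↔ S (φ x) (φ y)

/-- The bijection `R → S`, `(x, y) ↦ (φ x, φ y)`. -/
def Carries.graphEquiv {X Y : Type u} {R : Setoid X} {S : Setoid Y} {φ : X ≃ Y}
    (h : Carries R S φ) : Graph R ≃ Graph S :=
  (φ.prodCongr φ).subtypeEquiv fun p => h p.1 p.2

/-- The bijection `R → S` induced by the homeomorphism `φ : X → Y` is itself a homeomorphism for the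
inductive limit topologies, so that `φ` is an isomorphism of topological groupoids. -/
def IsTopIso {X Y : Type u} [TopologicalSpace X] [TopologicalSpace Y] {R : Setoid X} {S : Setoid Y}
    (𝓔 : Exhaustion R) (𝓕 : Exhaustion S) (φ : X ≃ₜ Y) (h : Carries R S φ.toEquiv) : Prop :=
  @IsHomeomorph _ _ 𝓔.limTopology 𝓕.limTopology h.graphEquiv

/-! ### Bratteli diagrams -/

/-- A Bratteli diagram: `V n` is the set of vertices of level `n`, and `E n` is the set of edges
from level `n` to level `n + 1`. Every vertex emits finitely many, but at least one, edges. -/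
structure BratteliDiagram where
  V : ℕ → Type u
  E : ℕ → Type u
  s : ∀ {n}, E n → V n
  r : ∀ {n}, E n → V (n + 1)
  finite_out : ∀ {n} (v : V n), {e : E n | s e = v}.Finite
  nonempty_out : ∀ {n} (v : V n), {e : E n | s e = v}.Nonempty

namespace BratteliDiagram

/-- Infinite paths starting at level `0`; `x n` is the edge from level `n` to level `n + 1`. -/
def Path (B : BratteliDiagram.{u}) : Type u :=
  {x : ∀ n, B.E n // ∀ n, B.r (x n) = B.s (x (n + 1))}

variable (B : BratteliDiagram.{u})

/-- The cylinder set of the first `n` edges of `x`. -/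
def cylinder (x : B.Path) (n : ℕ) : Set B.Path :=
  {y | ∀ k < n, y.1 k = x.1 k}

/-- The topology generated by the cylinder sets. -/
instance : TopologicalSpace B.Path :=
  TopologicalSpace.generateFrom {U | ∃ x n, U = B.cylinder x n}

/-- The relation of having the same edges from level `N` on. -/
def tailFrom (N : ℕ) : Setoid B.Path where
  r x y := ∀ n, N ≤ n → x.1 n = y.1 n
  iseqv :=
    { refl := fun _ _ _ => rfl
      symm := fun h n hn => (h n hn).symm
      trans := fun h h' n hn => (h n hn).trans (h' n hn) }

/-- The tail equivalence relation: having the same edges from some level on. -/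
def tail : Setoid B.Path where
  r x y := ∃ N, ∀ n, N ≤ n → x.1 n = y.1 n
  iseqv :=
    { refl := fun _ => ⟨0, fun _ _ => rfl⟩
      symm := fun ⟨N, h⟩ => ⟨N, fun n hn => (h n hn).symm⟩
      trans := fun ⟨N, h⟩ ⟨N', h'⟩ => ⟨max N N', fun n hn =>
        (h n (le_trans (le_max_left _ _) hn)).trans (h' n (le_trans (le_max_right _ _) hn))⟩ }

/-- The tail equivalence relation as the increasing union of the relations `tailFrom N`. -/
def tailExhaustion : Exhaustion B.tail where
  rel := B.tailFrom
  mono := fun _ _ hab _ _ h n hn => h n (le_trans hab hn)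
  union := fun _ _ => Iff.rfl

variable {A : Type v} [Group A]

/-- The ordered product of the labels of the first `n` edges of `x`. -/
def labelProd {B : BratteliDiagram.{u}} (f : ∀ n, B.E n → A) (x : B.Path) : ℕ → A
  | 0 => 1
  | n + 1 => labelProd f x n * f n (x.1 n)

/-- `c` is a quasi-product cocycle: for some labelling `f` of the edges, `c(x,y)` is the limit of
`f(x₁) ⋯ f(xₙ) f(yₙ)⁻¹ ⋯ f(y₁)⁻¹`. That sequence is eventually constant, so the limit, which
makes sense in any group, is its eventual value. -/
def IsQuasiProduct (c : Graph B.tail → A) : Prop :=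
  IsCocycle B.tail c ∧ ∃ f : ∀ n, B.E n → A, ∀ p : Graph B.tail,
    ∀ᶠ n in Filter.atTop, labelProd f p.1.1 n * (labelProd f p.1.2 n)⁻¹ = c p

end BratteliDiagram

end AFRel

namespace AFRel

open Set Filter Topology

/-! ### Partitions into open sets -/

/-! The diagram comes from a decreasing, point-separating sequence of finite clopen partitions K_n.
Let S_0 be the diagonal and S_{n+1} = R_n (`Exhaustion.shift`). Each K_n is adapted to S_n
(`IsEtale.exists_isAdapted`): an S_n-class meets a cell at most once, and two classes that meet one
cell in common meet the same cells. Vertices of level n are the S_n-classes up to K_n, edges are the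
S_n-classes up to the finer K_{n+1}, seen inside their S_{n+1}-classes. A point is sent to its
sequence of edges. S_N-equivalent points share all edges from level N on; conversely, the edges
below N single out one point of an S_N-class (`TypeSystem.rel_iff_tailFrom`).

If c is continuous with finitely many values on each R_n, it is locally constant there, so K_n can
also make c constant along pairs of cells. Choose a base point ρ_n(x) in each S_n-class, in the same
cell for all classes of one type. Then c(ρ_n(x), ρ_{n+1}(x)) depends only on the edge of x and
labels it. As ρ_0(x) = x, the products telescope to c(x, ρ_n(x)), and ρ_n(x) = ρ_n(y) once (x, y)
lies in S_n.

For general c, base points give c(x,y) = g_n(x) g_n(y)⁻¹ on R_n with g_n continuous. One builds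
locally constant k_n such that the maps b_n = k_n g_n⁻¹ converge uniformly and k_n⁻¹ k_{n+1} is
R_n-invariant. On R_N, conjugating c by any b_n with n ≥ N gives k_N(x) k_N(y)⁻¹; the limit b does
the same, and k_N has finite range. -/

/-- The classes of `K` are open. -/
def OpenClasses {X : Type u} [TopologicalSpace X] (K : Setoid X) : Prop :=
  ∀ x, IsOpen {y | K x y}

/-- The saturation of `U` under `R`. -/
def saturation {X : Type u} (R : Setoid X) (U : Set X) : Set X :=
  {x | ∃ y ∈ U, R x y}

section Partitions

variable {X : Type u} [TopologicalSpace X]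

theorem OpenClasses.inf {K L : Setoid X} (hK : OpenClasses K) (hL : OpenClasses L) :
    OpenClasses (K ⊓ L) :=
  fun x => (hK x).inter (hL x)

theorem OpenClasses.top : OpenClasses (⊤ : Setoid X) :=
  fun _ => isOpen_univ

theorem OpenClasses.isLocallyConstant {K : Setoid X} (hK : OpenClasses K) :
    IsLocallyConstant (Quotient.mk K) := by
  rw [IsLocallyConstant.iff_exists_open]
  exact fun x => ⟨{y | K x y}, hK x, K.refl x, fun y hy => Quotient.sound (K.symm hy)⟩

theorem OpenClasses.finite_quotient [CompactSpace X] {K : Setoid X} (hK : OpenClasses K) :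
    Finite (Quotient K) := by
  rw [← finite_univ_iff, ← Quotient.mk_surjective.range_eq]
  exact hK.isLocallyConstant.range_finite

/-- Membership in finitely many clopen sets partitions the space into open sets. -/
theorem OpenClasses.ker_mem {ι : Type*} [Finite ι] (Q : ι → Set X) (hQ : ∀ i, IsClopen (Q i)) :
    OpenClasses (Setoid.ker fun x i => x ∈ Q i) := by
  intro x
  have : {y | Setoid.ker (fun x i => x ∈ Q i) x y} = ⋂ i, {y | (x ∈ Q i) = (y ∈ Q i)} := by
    ext y
    simp [Setoid.ker_def, funext_iff]
  rw [this]
  refine isOpen_iInter_of_finite fun i => ?_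
  by_cases h : x ∈ Q i
  · simpa [h] using (hQ i).isOpen
  · simp only [h, eq_iff_iff, false_iff]
    exact (hQ i).compl.isOpen

end Partitions

/-! ### Étale relations -/

/-- The properties of a proper relation that are used below. -/
structure IsEtale {X : Type u} [TopologicalSpace X] (R : Setoid X) : Prop where
  isClosed_graph : IsClosed {p : X × X | R p.1 p.2}
  isOpen_saturation : ∀ U, IsOpen U → IsOpen (saturation R U)
  injective_nhds : ∀ x, ∃ U, IsOpen U ∧ x ∈ U ∧ ∀ y ∈ U, ∀ z ∈ U, R y z → y = z

section Etale

variable {X : Type u} [TopologicalSpace X]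

theorem IsProper.isEtale {R : Setoid X} (h : IsProper R) : IsEtale R where
  isClosed_graph := h.isClosed_graph
  isOpen_saturation U hU := by
    have : saturation R U = Quotient.mk R ⁻¹' (Quotient.mk R '' U) := by
      ext x
      exact ⟨fun ⟨y, hy, hxy⟩ => ⟨y, hy, Quotient.sound (R.symm hxy)⟩,
        fun ⟨y, hy, hxy⟩ => ⟨y, hy, R.symm (Quotient.exact hxy)⟩⟩
    rw [this]
    exact (h.isLocalHomeomorph_mk.isOpenMap U hU).preimage h.isLocalHomeomorph_mk.continuous
  injective_nhds x := by
    obtain ⟨e, hx, he⟩ := h.isLocalHomeomorph_mk x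
    refine ⟨e.source, e.open_source, hx, fun y hy z hz hyz => e.injOn hy hz ?_⟩
    rw [← he]
    exact Quotient.sound hyz

theorem IsEtale.bot [T2Space X] : IsEtale (⊥ : Setoid X) where
  isClosed_graph := isClosed_diagonal
  isOpen_saturation U hU := by
    have : saturation ⊥ U = U := by
      ext x
      exact ⟨fun ⟨y, hy, hxy⟩ => (show x = y from hxy) ▸ hy, fun hx => ⟨x, hx, rfl⟩⟩
    rwa [this]
  injective_nhds x := ⟨univ, isOpen_univ, mem_univ x, fun _ _ _ _ h => h⟩

theorem IsEtale.isClosed_saturation [CompactSpace X] {R : Setoid X} (hR : IsEtale R)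
    {C : Set X} (hC : IsClosed C) : IsClosed (saturation R C) := by
  have : saturation R C = Prod.fst '' ({p : X × X | R p.1 p.2} ∩ Prod.snd ⁻¹' C) := by
    ext x
    exact ⟨fun ⟨y, hy, hxy⟩ => ⟨(x, y), ⟨hxy, hy⟩, rfl⟩,
      fun ⟨p, ⟨hp, hp'⟩, h⟩ => ⟨p.2, hp', h ▸ hp⟩⟩
  rw [this]
  exact isClosedMap_fst_of_compactSpace _ (hR.isClosed_graph.inter (hC.preimage continuous_snd))

theorem IsEtale.isClopen_saturation [CompactSpace X] {R : Setoid X} (hR : IsEtale R)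
    {C : Set X} (hC : IsClopen C) : IsClopen (saturation R C) :=
  ⟨hR.isClosed_saturation hC.isClosed, hR.isOpen_saturation C hC.isOpen⟩

theorem saturation_congr {X : Type u} {R : Setoid X} {U : Set X} {x y : X} (h : R x y) :
    x ∈ saturation R U ↔ y ∈ saturation R U :=
  ⟨fun ⟨z, hz, hxz⟩ => ⟨z, hz, R.trans (R.symm h) hxz⟩,
    fun ⟨z, hz, hyz⟩ => ⟨z, hz, R.trans h hyz⟩⟩

/-- The function `d` on pairs of points is locally constant along the graph of `R`. -/
def LocConstOn (R : Setoid X) {D : Type*} (d : X → X → D) : Prop :=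
  ∀ x y, R x y → ∃ U V, IsOpen U ∧ IsOpen V ∧ x ∈ U ∧ y ∈ V ∧
    ∀ x' ∈ U, ∀ y' ∈ V, R x' y' → d x' y' = d x y

theorem LocConstOn.prodMk {R : Setoid X} {D D' : Type*} {d : X → X → D} {d' : X → X → D'}
    (h : LocConstOn R d) (h' : LocConstOn R d') : LocConstOn R fun x y => (d x y, d' x y) := by
  intro x y hxy
  obtain ⟨U, V, hU, hV, hx, hy, H⟩ := h x y hxy
  obtain ⟨U', V', hU', hV', hx', hy', H'⟩ := h' x y hxy
  exact ⟨U ∩ U', V ∩ V', hU.inter hU', hV.inter hV', ⟨hx, hx'⟩, ⟨hy, hy'⟩,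
    fun a ha b hb hab => Prod.ext (H a ha.1 b hb.1 hab) (H' a ha.2 b hb.2 hab)⟩

/-- A smaller étale relation is open and closed in a larger one. -/
theorem IsEtale.locConstOn_of_le {R S : Setoid X} (hR : IsEtale R) (hS : IsEtale S)
    (hSR : S ≤ R) : LocConstOn R fun x y => S x y := by
  intro x y _
  by_cases hxy : S x y
  -- Near y the classes of `R` are separated, so the `S`-partner of x' in `V` is forced to be its
  -- only `R`-partner there.
  · obtain ⟨V, hV, hy, hinj⟩ := hR.injective_nhds y
    refine ⟨saturation S V, V, hS.isOpen_saturation V hV, hV, ⟨y, hy, hxy⟩, hy, ?_⟩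
    rintro x' ⟨z, hz, hxz⟩ y' hy' hxy'
    have : z = y' := hinj z hz y' hy' (R.trans (R.symm (hSR hxz)) hxy')
    exact propext ⟨fun _ => hxy, fun _ => this ▸ hxz⟩
  · obtain ⟨U, V, hU, hV, hx, hy, hUV⟩ := isOpen_prod_iff.1 hS.isClosed_graph.isOpen_compl x y hxy
    exact ⟨U, V, hU, hV, hx, hy, fun x' hx' y' hy' _ =>
      propext ⟨fun h => absurd h (hUV (mk_mem_prod hx' hy')), fun h => absurd h hxy⟩⟩

theorem IsEtale.locConstOn_eq [T2Space X] {R : Setoid X} (hR : IsEtale R) :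
    LocConstOn R fun x y => x = y :=
  hR.locConstOn_of_le IsEtale.bot bot_le

variable [CompactSpace X] [T2Space X] [TotallyDisconnectedSpace X]

/-- A function that is locally constant along the compact graph of `R` only depends on the cells
of a sufficiently fine open partition. -/
theorem IsEtale.exists_le_forall_eq {R : Setoid X} (hR : IsEtale R) {D : Type*} {d : X → X → D}
    (hd : LocConstOn R d) {K : Setoid X} (hK : OpenClasses K) :
    ∃ L ≤ K, OpenClasses L ∧
      ∀ x y x' y', L x y → L x' y' → R x x' → R y y' → d x x' = d y y' := by
  have key : ∀ p : X × X, ∃ U V, IsClopen U ∧ IsClopen V ∧ p.1 ∈ U ∧ p.2 ∈ V ∧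
      ∀ x ∈ U, ∀ y ∈ V, R x y → d x y = d p.1 p.2 := by
    rintro ⟨x, y⟩
    obtain ⟨U, V, hU, hV, hx, hy, H⟩ : ∃ U V, IsOpen U ∧ IsOpen V ∧ x ∈ U ∧ y ∈ V ∧
        ∀ x' ∈ U, ∀ y' ∈ V, R x' y' → d x' y' = d x y := by
      by_cases hxy : R x y
      · exact hd x y hxy
      · obtain ⟨U, V, hU, hV, hx, hy, hUV⟩ :=
          isOpen_prod_iff.1 hR.isClosed_graph.isOpen_compl x y hxy
        exact ⟨U, V, hU, hV, hx, hy, fun x' hx' y' hy' h =>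
          absurd h (hUV (mk_mem_prod hx' hy'))⟩
    obtain ⟨U', hU', hxU', hUU'⟩ := compact_exists_isClopen_in_isOpen hU hx
    obtain ⟨V', hV', hyV', hVV'⟩ := compact_exists_isClopen_in_isOpen hV hy
    exact ⟨U', V', hU', hV', hxU', hyV', fun a ha b hb => H a (hUU' ha) b (hVV' hb)⟩
  choose U V hU hV hxU hyV H using key
  obtain ⟨t, -, ht⟩ := isCompact_univ.elim_nhds_subcover (fun p => U p ×ˢ V p)
    fun p _ => prod_mem_nhds ((hU p).isOpen.mem_nhds (hxU p)) ((hV p).isOpen.mem_nhds (hyV p))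
  -- Cells record membership in both sides of every rectangle of a finite clopen cover of X × X, so
  -- cellwise equivalent pairs lie in a common rectangle.
  refine ⟨K ⊓ (Setoid.ker (fun x (p : t) => x ∈ U p.1) ⊓ Setoid.ker (fun x (p : t) => x ∈ V p.1)),
    inf_le_left, hK.inf ((OpenClasses.ker_mem (fun p : t => U p.1) fun p => hU p.1).inf
      (OpenClasses.ker_mem (fun p : t => V p.1) fun p => hV p.1)), ?_⟩
  rintro x y x' y' ⟨-, h, -⟩ ⟨-, -, h'⟩ hx hy
  obtain ⟨p, hp, hpU, hpV⟩ := mem_iUnion₂.1 (ht (mem_univ (x, x')))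
  have h1 : (x ∈ U p) = (y ∈ U p) := congrFun h ⟨p, hp⟩
  have h2 : (x' ∈ V p) = (y' ∈ V p) := congrFun h' ⟨p, hp⟩
  rw [H p x hpU x' hpV hx, H p y (h1 ▸ hpU) y' (h2 ▸ hpV) hy]

/-- `K` is a partition into open sets whose cells are permuted by partial homeomorphisms with
graphs in `R`, and along which `d` is constant. -/
structure IsAdapted (R : Setoid X) {D : Type*} (d : X → X → D) (K : Setoid X) : Prop where
  openClasses : OpenClasses K
  exists_lift : ∀ x y x', K x y → R x x' → ∃ y', R y y' ∧ K x' y'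
  apply_eq : ∀ x y x' y', K x y → K x' y' → R x x' → R y y' → d x x' = d y y'
  eq_of_rel : ∀ x y, K x y → R x y → x = y

/-- A partition `L` that makes `d` and equality constant is refined by the saturations of its own
cells. These are clopen, and knowing which of them contain a point tells which cells its class
meets. As they are `R`-invariant, the lifted point stays equivalent for the refined partition, and
no further refinement is needed. -/
theorem IsEtale.exists_isAdapted {R : Setoid X} (hR : IsEtale R) {D : Type*} {d : X → X → D}
    (hd : LocConstOn R d) {K : Setoid X} (hK : OpenClasses K) :
    ∃ L ≤ K, IsAdapted R d L := by
  obtain ⟨L, hLK, hL, hdL⟩ := hR.exists_le_forall_eq (hd.prodMk hR.locConstOn_eq) hK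
  have := hL.finite_quotient
  let Q : Quotient L → Set X := fun q => saturation R {y | Quotient.mk L y = q}
  have hQ : ∀ q, IsClopen (Q q) := fun q =>
    hR.isClopen_saturation (hL.isLocallyConstant.isClopen_fiber q)
  refine ⟨L ⊓ Setoid.ker fun x q => x ∈ Q q, inf_le_left.trans hLK,
    hL.inf (OpenClasses.ker_mem Q hQ), ?_, ?_, ?_⟩
  · rintro x y x' ⟨-, h⟩ hx
    have h1 : (x ∈ Q ⟦x'⟧) = (y ∈ Q ⟦x'⟧) := congrFun h _
    obtain ⟨y', hy', hyy'⟩ : y ∈ Q ⟦x'⟧ := h1 ▸ ⟨x', rfl, hx⟩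
    refine ⟨y', hyy', L.symm (Quotient.exact hy'), funext fun q => propext ?_⟩
    have h2 : (x ∈ Q q) = (y ∈ Q q) := congrFun h _
    exact (saturation_congr hx).symm.trans ((iff_of_eq h2).trans (saturation_congr hyy'))
  · exact fun x y x' y' h h' hx hy => congrArg Prod.fst (hdL x y x' y' h.1 h'.1 hx hy)
  · intro x y h hx
    -- The pairs (x, x) and (x, y) are cellwise equivalent and both in `R`, so both or neither are
    -- diagonal.
    have := congrArg Prod.snd (hdL x x x y (L.refl x) h.1 (R.refl x) hx)
    exact this.mp rfl

end Etale

/-! ### Bratteli diagrams from systems of partitions -/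

/-- Partitions of `X` into types of points, for an increasing sequence of relations `R n`: the cells
of `T n` become the vertices and those of `E n` the edges of a Bratteli diagram. -/
structure TypeSystem {X : Type u} [TopologicalSpace X] (R : ℕ → Setoid X) where
  T : ℕ → Setoid X
  E : ℕ → Setoid X
  openClasses : ∀ n, OpenClasses (E n)
  le_source : ∀ n, E n ≤ T n
  le_range : ∀ n, E n ≤ T (n + 1)
  rel_le : ∀ n, R n ≤ E n
  exists_lift : ∀ n x z, T (n + 1) x z → ∃ x', R (n + 1) x x' ∧ E n x' z
  eq_of_forall : ∀ x y, (∀ n, E n x y) → x = y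

instance (B : BratteliDiagram.{u}) : T2Space B.Path where
  t2 p q hpq := by
    obtain ⟨n, hn⟩ : ∃ n, p.1 n ≠ q.1 n := by
      by_contra! h
      exact hpq (Subtype.ext (funext h))
    refine ⟨B.cylinder p (n + 1), B.cylinder q (n + 1),
      TopologicalSpace.isOpen_generateFrom_of_mem ⟨p, n + 1, rfl⟩,
      TopologicalSpace.isOpen_generateFrom_of_mem ⟨q, n + 1, rfl⟩,
      fun _ _ => rfl, fun _ _ => rfl, ?_⟩
    rw [Set.disjoint_left]
    exact fun z hz hz' => hn ((hz n n.lt_succ_self).symm.trans (hz' n n.lt_succ_self))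

namespace TypeSystem

variable {X : Type u} [TopologicalSpace X] [CompactSpace X] {R : ℕ → Setoid X}

/-- The Bratteli diagram of a system of partitions. -/
def diagram (𝒯 : TypeSystem R) : BratteliDiagram.{u} where
  V n := Quotient (𝒯.T n)
  E n := Quotient (𝒯.E n)
  s {n} := Quotient.map id fun _ _ h => 𝒯.le_source n h
  r {n} := Quotient.map id fun _ _ h => 𝒯.le_range n h
  finite_out {n} _ := by
    have := (𝒯.openClasses n).finite_quotient
    exact toFinite _
  nonempty_out {n} v := by
    induction v using Quotient.inductionOn with
    | h x => exact ⟨Quotient.mk _ x, rfl⟩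

/-- The path of edges through a point. -/
def pathOf (𝒯 : TypeSystem R) (x : X) : 𝒯.diagram.Path :=
  ⟨fun n => Quotient.mk (𝒯.E n) x, fun _ => rfl⟩

variable (𝒯 : TypeSystem R)

/-- Initial segments of paths can be followed backwards inside the classes of `R n`. -/
theorem exists_rel_forall_lt (hR : Monotone R) (p : 𝒯.diagram.Path) (n : ℕ) :
    ∀ y : X, Quotient.mk (𝒯.T n) y = 𝒯.diagram.s (p.1 n) →
      ∃ x, R n y x ∧ ∀ k < n, Quotient.mk (𝒯.E k) x = p.1 k := by
  induction n with
  | zero => exact fun y _ => ⟨y, (R 0).refl y, fun k hk => absurd hk (Nat.not_lt_zero k)⟩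
  | succ n ih =>
    intro y hy
    obtain ⟨z, hz⟩ := Quotient.exists_rep (p.1 n)
    rw [← p.2 n, ← hz] at hy
    obtain ⟨y', hyy', hy'z⟩ := 𝒯.exists_lift n y z (Quotient.exact hy)
    have hy' : Quotient.mk (𝒯.E n) y' = p.1 n := (Quotient.sound hy'z).trans hz
    obtain ⟨x, hx, hxk⟩ := ih y' (by rw [← hy']; rfl)
    refine ⟨x, (R (n + 1)).trans hyy' (hR n.le_succ hx), fun k hk => ?_⟩
    rcases Nat.lt_succ_iff_lt_or_eq.1 hk with hk | rfl
    · exact hxk k hk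
    · exact (Quotient.sound ((𝒯.E k).symm (𝒯.rel_le k hx))).trans hy'

theorem pathOf_injective : Function.Injective 𝒯.pathOf := fun x y h =>
  𝒯.eq_of_forall x y fun n => Quotient.exact (congrFun (congrArg Subtype.val h) n)

/-- Every initial segment of a path is realized by a point, and compactness gives a point that
realizes them all. -/
theorem pathOf_surjective (hR : Monotone R) : Function.Surjective 𝒯.pathOf := by
  intro p
  let C : ℕ → Set X := fun m => {x | ∀ k < m, Quotient.mk (𝒯.E k) x = p.1 k}
  have hC : ∀ m, IsClosed (C m) := fun m => by
    simp only [C, ofPred_forall]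
    exact isClosed_iInter fun k => isClosed_iInter fun _ =>
      (𝒯.openClasses k).isLocallyConstant.isClosed_fiber _
  have hne : ∀ m, (C m).Nonempty := fun m => by
    obtain ⟨y, hy⟩ := Quotient.exists_rep (p.1 m)
    obtain ⟨x, -, hx⟩ := 𝒯.exists_rel_forall_lt hR p m y (by rw [← hy]; rfl)
    exact ⟨x, hx⟩
  obtain ⟨x, hx⟩ := IsCompact.nonempty_iInter_of_sequence_nonempty_isCompact_isClosed C
    (fun m x hx k hk => hx k (hk.trans m.lt_succ_self)) hne (hC 0).isCompact hC
  exact ⟨x, Subtype.ext (funext fun n => mem_iInter.1 hx (n + 1) n n.lt_succ_self)⟩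

theorem continuous_pathOf : Continuous 𝒯.pathOf := by
  refine continuous_generateFrom_iff.2 ?_
  rintro _ ⟨p, n, rfl⟩
  have : 𝒯.pathOf ⁻¹' 𝒯.diagram.cylinder p n =
      ⋂ k ∈ Finset.range n, {x | Quotient.mk (𝒯.E k) x = p.1 k} := by
    ext x
    simp only [Finset.mem_range, mem_iInter]
    rfl
  rw [this]
  exact isOpen_biInter_finset fun k _ => (𝒯.openClasses k).isLocallyConstant.isOpen_fiber _

/-- The identification of `X` with the path space. -/
noncomputable def homeo (hR : Monotone R) : X ≃ₜ 𝒯.diagram.Path :=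
  Continuous.homeoOfEquivCompactToT2
    (f := Equiv.ofBijective 𝒯.pathOf ⟨𝒯.pathOf_injective, 𝒯.pathOf_surjective hR⟩)
    𝒯.continuous_pathOf

/-- If the tails agree, then x and y have the same vertex at level `N`, so the initial edges of x
can be followed back from y inside its `R N`-class. The point reached has all the edges of x, hence
is x. -/
theorem rel_iff_tailFrom (hR : Monotone R) (N : ℕ) (x y : X) :
    R N x y ↔ 𝒯.diagram.tailFrom N (𝒯.homeo hR x) (𝒯.homeo hR y) := by
  constructor
  · exact fun h n hn => Quotient.sound (𝒯.rel_le n (hR hn h))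
  · intro h
    obtain ⟨x', hyx', hx'⟩ := 𝒯.exists_rel_forall_lt hR (𝒯.pathOf x) N y
      (congrArg 𝒯.diagram.s (h N le_rfl)).symm
    have : x' = x := by
      refine 𝒯.eq_of_forall x' x fun n => ?_
      rcases lt_or_ge n N with hn | hn
      · exact Quotient.exact (hx' n hn)
      · exact (𝒯.E n).trans ((𝒯.E n).symm (𝒯.rel_le n (hR hn hyx')))
          ((𝒯.E n).symm (Quotient.exact (h n hn)))
    exact (R N).symm (this ▸ hyx')

end TypeSystem

/-! ### The inductive limit topology -/

section LimTopology

variable {X Y : Type u} [TopologicalSpace X] [TopologicalSpace Y] {R : Setoid X} {S : Setoid Y}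

theorem Exhaustion.continuous_iff (𝓔 : Exhaustion R) {Z : Type*} {t : TopologicalSpace Z}
    {f : Graph R → Z} : @Continuous _ _ 𝓔.limTopology t f ↔ ∀ n, Continuous (f ∘ 𝓔.incl n) := by
  simp only [continuous_iSup_dom, continuous_coinduced_dom]

theorem Exhaustion.continuous_incl (𝓔 : Exhaustion R) (n : ℕ) :
    @Continuous _ _ _ 𝓔.limTopology (𝓔.incl n) :=
  𝓔.continuous_iff.1 (@continuous_id _ 𝓔.limTopology) n

/-- A map of relations which respects the exhaustions is continuous. -/
theorem Exhaustion.continuous_of_forall_exists (𝓔 : Exhaustion R) (𝓕 : Exhaustion S) {φ : X → Y}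
    (hφ : Continuous φ) (h : ∀ n, ∃ m, ∀ x y, 𝓔.rel n x y → 𝓕.rel m (φ x) (φ y))
    {F : Graph R → Graph S} (hF : ∀ p, (F p).1 = (φ p.1.1, φ p.1.2)) :
    @Continuous _ _ 𝓔.limTopology 𝓕.limTopology F := by
  let := 𝓕.limTopology
  refine 𝓔.continuous_iff.2 fun n => ?_
  obtain ⟨m, hm⟩ := h n
  let G : Graph (𝓔.rel n) → Graph (𝓕.rel m) := fun p => ⟨(φ p.1.1, φ p.1.2), hm _ _ p.2⟩
  have hG : Continuous G := by
    refine Continuous.subtype_mk ?_ _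
    fun_prop
  have : F ∘ 𝓔.incl n = 𝓕.incl m ∘ G := funext fun p => Subtype.ext (hF _)
  rw [this]
  exact (𝓕.continuous_incl m).comp hG

theorem isTopIso_of_forall_exists (𝓔 : Exhaustion R) (𝓕 : Exhaustion S) (φ : X ≃ₜ Y)
    (h : Carries R S φ.toEquiv)
    (h₁ : ∀ n, ∃ m, ∀ x y, 𝓔.rel n x y → 𝓕.rel m (φ x) (φ y))
    (h₂ : ∀ n, ∃ m, ∀ x y, 𝓕.rel n x y → 𝓔.rel m (φ.symm x) (φ.symm y)) :
    IsTopIso 𝓔 𝓕 φ h := by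
  let := 𝓔.limTopology
  let := 𝓕.limTopology
  let e : Graph R ≃ₜ Graph S :=
    { h.graphEquiv with
      continuous_toFun := 𝓔.continuous_of_forall_exists 𝓕 φ.continuous h₁ fun _ => rfl
      continuous_invFun := 𝓕.continuous_of_forall_exists 𝓔 φ.symm.continuous h₂ fun _ => rfl }
  exact e.isHomeomorph

end LimTopology

/-- The relations of an exhaustion, preceded by the trivial relation. -/
def Exhaustion.shift {X : Type u} {R : Setoid X} (𝓔 : Exhaustion R) : ℕ → Setoid X
  | 0 => ⊥
  | n + 1 => 𝓔.rel n

namespace Exhaustion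

variable {X : Type u} {R : Setoid X} (𝓔 : Exhaustion R)

theorem monotone_shift : Monotone 𝓔.shift := by
  refine monotone_nat_of_le_succ fun n => ?_
  cases n with
  | zero => exact bot_le
  | succ n => exact 𝓔.mono n.le_succ

theorem rel_of_shift {n : ℕ} {x y : X} (h : 𝓔.shift n x y) : R x y := by
  cases n with
  | zero => exact (show x = y from h) ▸ R.refl x
  | succ n => exact (𝓔.union x y).2 ⟨n, h⟩

theorem isEtale_shift [TopologicalSpace X] [T2Space X] (h : 𝓔.IsAF) (n : ℕ) :
    IsEtale (𝓔.shift n) := by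
  cases n with
  | zero => exact IsEtale.bot
  | succ n => exact (h.proper n).isEtale

end Exhaustion

theorem TypeSystem.exists_isTopIso {X : Type u} [TopologicalSpace X] [CompactSpace X]
    {R : Setoid X} (𝓔 : Exhaustion R) (𝒯 : TypeSystem 𝓔.shift) :
    ∃ h : Carries R 𝒯.diagram.tail (𝒯.homeo 𝓔.monotone_shift).toEquiv,
      IsTopIso 𝓔 𝒯.diagram.tailExhaustion (𝒯.homeo 𝓔.monotone_shift) h := by
  have key := 𝒯.rel_iff_tailFrom 𝓔.monotone_shift
  refine ⟨fun x y => ⟨fun h => ?_, fun ⟨N, h⟩ => 𝓔.rel_of_shift ((key N x y).2 h)⟩, ?_⟩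
  · obtain ⟨n, hn⟩ := (𝓔.union x y).1 h
    exact ⟨n + 1, (key (n + 1) x y).1 hn⟩
  -- `𝓔.rel n` is `𝓔.shift (n + 1)`, while `tailFrom n` matches `𝓔.shift n`, which is contained in
  -- `𝓔.rel n`.
  · refine isTopIso_of_forall_exists _ _ _ _ (fun n => ⟨n + 1, fun x y => (key (n + 1) x y).1⟩)
      fun n => ⟨n, fun x y h => ?_⟩
    refine 𝓔.monotone_shift n.le_succ ((key n _ _).2 ?_)
    simpa using! h

/-! ### Types of points -/

section Join

variable {X : Type u}

/-- The join of two relations, the second of which lifts along the first. -/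
def joinSetoid (S K : Setoid X) (h : ∀ x y x', K x y → S x x' → ∃ y', S y y' ∧ K x' y') :
    Setoid X where
  r x y := ∃ x', S x x' ∧ K x' y
  iseqv :=
    { refl := fun x => ⟨x, S.refl x, K.refl x⟩
      symm := fun {x y} ⟨x', hx, hy⟩ => by
        obtain ⟨y', hyy', hxy'⟩ := h x' y x hy (S.symm hx)
        exact ⟨y', hyy', K.symm hxy'⟩
      trans := fun {x y z} ⟨x', hx, hy⟩ ⟨y', hyy', hz⟩ => by
        obtain ⟨x'', hx'', hxy''⟩ := h y x' y' (K.symm hy) hyy'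
        exact ⟨x'', S.trans hx hx'', K.trans (K.symm hxy'') hz⟩ }

theorem openClasses_joinSetoid [TopologicalSpace X] {S K : Setoid X} (h) (hK : OpenClasses K) :
    OpenClasses (joinSetoid S K h) := by
  intro x
  have : {y | joinSetoid S K h x y} = ⋃ x' ∈ {x' | S x x'}, {y | K x' y} := by
    ext y
    simp only [mem_iUnion, exists_prop]
    rfl
  rw [this]
  exact isOpen_biUnion fun x' _ => hK x'

end Join

/-! ### Continuous base points. -/

section Section

variable {X : Type u} [TopologicalSpace X]

/-- A map into a compact space with closed graph is continuous. -/
theorem continuous_of_isClosed_graph {Y : Type*} [TopologicalSpace Y] [CompactSpace Y] {f : X → Y}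
    (h : IsClosed {p : X × Y | f p.1 = p.2}) : Continuous f := by
  refine continuous_iff_isClosed.2 fun C hC => ?_
  have : f ⁻¹' C = Prod.fst '' ({p : X × Y | f p.1 = p.2} ∩ Prod.snd ⁻¹' C) := by
    ext x
    exact ⟨fun hx => ⟨(x, f x), ⟨rfl, hx⟩, rfl⟩,
      fun ⟨p, ⟨hp, hp'⟩, hx⟩ => by
        rw [← hx, mem_preimage, show f p.1 = p.2 from hp]
        exact hp'⟩
  rw [this]
  exact isClosedMap_fst_of_compactSpace _ (h.inter (hC.preimage continuous_snd))

/-- The type of a point relative to an adapted partition. -/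
def IsAdapted.type {R K : Setoid X} {D : Type*} {d : X → X → D} (h : IsAdapted R d K) : Setoid X :=
  joinSetoid R K h.exists_lift

/-- A choice of base points in the classes of `R`, in the same position for classes of the
same type. -/
theorem IsAdapted.exists_basePoint [CompactSpace X] {R K : Setoid X} {D : Type*} {d : X → X → D}
    (h : IsAdapted R d K) (hR : IsClosed {p : X × X | R p.1 p.2}) :
    ∃ ρ : X → X, Continuous ρ ∧ (∀ x, R x (ρ x)) ∧ (∀ x y, R x y → ρ x = ρ y) ∧
      ∀ x y, h.type x y → K (ρ x) (ρ y) := by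
  have key : ∀ x, ∃ x', R x x' ∧ K x' (Quotient.mk h.type x).out :=
    fun x => h.type.symm (Quotient.mk_out (s := h.type) x)
  choose ρ hρ hK using key
  have htype : ∀ x y, h.type x y → K (ρ x) (ρ y) := fun x y hxy =>
    K.trans (hK x) (by rw [Quotient.sound hxy]; exact K.symm (hK y))
  refine ⟨ρ, continuous_of_isClosed_graph ?_, hρ, fun x y hxy => ?_, htype⟩
  -- `ρ x` is the only point of the class of x in the cell of the chosen representative of its type.
  -- So the graph of `ρ` is cut out of the closed graph of `R` by a locally constant condition.
  · have : {p : X × X | ρ p.1 = p.2} = {p | R p.1 p.2} ∩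
        ((fun p : X × X => (Quotient.mk h.type p.1, Quotient.mk K p.2)) ⁻¹'
          {q | q.2 = Quotient.mk K q.1.out}) := by
      ext ⟨x, y⟩
      constructor
      · intro hxy
        obtain rfl : ρ x = y := hxy
        exact ⟨hρ x, Quotient.sound (hK x)⟩
      · rintro ⟨hxy, hy⟩
        exact h.eq_of_rel _ _ (K.trans (hK x) (K.symm (Quotient.exact hy)))
          (R.trans (R.symm (hρ x)) hxy)
    rw [this]
    have h1 := (openClasses_joinSetoid h.exists_lift h.openClasses).isLocallyConstant.comp_continuous
      (continuous_fst (X := X) (Y := X))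
    have h2 := h.openClasses.isLocallyConstant.comp_continuous (continuous_snd (X := X) (Y := X))
    refine hR.inter ⟨?_⟩
    rw [← preimage_compl]
    exact h1.prodMk h2 _
  · exact h.eq_of_rel _ _ (htype x y ⟨y, hxy, K.refl y⟩)
      (R.trans (R.symm (hρ x)) (R.trans hxy (hρ y)))

end Section

/-! ### Extension of cocycles by `1` -/

section Extend

variable {X : Type u} {R : Setoid X} {A : Type v} [Group A]

open Classical in
/-- The extension by `1` of a function on `R` to all pairs of points. -/
noncomputable def extendOne (c : Graph R → A) (x y : X) : A :=
  if h : R x y then c ⟨(x, y), h⟩ else 1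

theorem extendOne_of_rel (c : Graph R → A) {x y : X} (h : R x y) :
    extendOne c x y = c ⟨(x, y), h⟩ :=
  dif_pos h

theorem IsCocycle.extendOne_mul {c : Graph R → A} (hc : IsCocycle R c) {x y z : X} (hxy : R x y)
    (hyz : R y z) : extendOne c x y * extendOne c y z = extendOne c x z := by
  rw [extendOne_of_rel c hxy, extendOne_of_rel c hyz, extendOne_of_rel c (R.trans hxy hyz),
    hc x y z hxy hyz]

theorem IsCocycle.extendOne_self {c : Graph R → A} (hc : IsCocycle R c) (x : X) :
    extendOne c x x = 1 := by
  simpa using hc.extendOne_mul (R.refl x) (R.refl x)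

theorem IsCocycle.extendOne_inv {c : Graph R → A} (hc : IsCocycle R c) {x y : X} (hxy : R x y) :
    (extendOne c x y)⁻¹ = extendOne c y x := by
  rw [inv_eq_iff_mul_eq_one, hc.extendOne_mul hxy (R.symm hxy), hc.extendOne_self]

theorem LocConstOn.mono [TopologicalSpace X] {R S : Setoid X} (hRS : R ≤ S) {D : Type*}
    {d : X → X → D} (h : LocConstOn S d) : LocConstOn R d := by
  intro x y hxy
  obtain ⟨U, V, hU, hV, hx, hy, H⟩ := h x y (hRS hxy)
  exact ⟨U, V, hU, hV, hx, hy, fun a ha b hb hab => H a ha b hb (hRS hab)⟩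

/-- A continuous function with finitely many values is locally constant. -/
theorem isLocallyConstant_of_finite_range {Z Y : Type*} [TopologicalSpace Z] [TopologicalSpace Y]
    [T1Space Y] {f : Z → Y} (hf : Continuous f) (h : (range f).Finite) : IsLocallyConstant f := by
  rw [IsLocallyConstant.iff_isOpen_fiber]
  intro y
  have : f ⁻¹' {y} = f ⁻¹' (range f \ {y})ᶜ := by
    ext z
    simp
  rw [this]
  exact (h.subset sdiff_subset).isClosed.isOpen_compl.preimage hf

theorem locConstOn_extendOne [TopologicalSpace X] [TopologicalSpace A] [T1Space A]
    (𝓔 : Exhaustion R) {c : Graph R → A} (hc : @Continuous _ _ 𝓔.limTopology _ c)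
    (hfin : FinitelyValuedOnEach 𝓔 c) (n : ℕ) : LocConstOn (𝓔.rel n) (extendOne c) := by
  intro x y hxy
  obtain ⟨W, hW, hxyW, H⟩ := (isLocallyConstant_of_finite_range (𝓔.continuous_iff.1 hc n)
    (hfin n)).exists_open ⟨(x, y), hxy⟩
  obtain ⟨W', hW', rfl⟩ := isOpen_induced_iff.1 hW
  obtain ⟨U, V, hU, hV, hx, hy, hUV⟩ := isOpen_prod_iff.1 hW' x y hxyW
  refine ⟨U, V, hU, hV, hx, hy, fun x' hx' y' hy' h => ?_⟩
  have h1 : R x' y' := (𝓔.union _ _).2 ⟨n, h⟩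
  have h2 : R x y := (𝓔.union _ _).2 ⟨n, hxy⟩
  rw [extendOne_of_rel c h1, extendOne_of_rel c h2]
  exact H ⟨(x', y'), h⟩ (hUV (mk_mem_prod hx' hy'))

theorem locConstOn_extendOne_shift [TopologicalSpace X] [TopologicalSpace A] [T1Space A]
    (𝓔 : Exhaustion R) {c : Graph R → A} (hc : @Continuous _ _ 𝓔.limTopology _ c)
    (hfin : FinitelyValuedOnEach 𝓔 c) (n : ℕ) : LocConstOn (𝓔.shift n) (extendOne c) :=
  (locConstOn_extendOne 𝓔 hc hfin n).mono (𝓔.monotone_shift n.le_succ)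

end Extend

/-! ### Finitely valued cocycles -/

/-- Successive refinement of open partitions. -/
theorem exists_antitone_openClasses {X : Type u} [TopologicalSpace X] {P : ℕ → Setoid X → Prop}
    (h : ∀ n K, OpenClasses K → ∃ L ≤ K, OpenClasses L ∧ P n L) :
    ∃ K : ℕ → Setoid X, Antitone K ∧ ∀ n, P n (K n) := by
  choose F hF hF' hP using h
  -- The trivial partition only starts the recursion; the sequence returned begins at index 1.
  let K : ℕ → {K : Setoid X // OpenClasses K} := fun n =>
    Nat.rec ⟨⊤, OpenClasses.top⟩ (fun n K => ⟨F n K.1 K.2, hF' n K.1 K.2⟩) n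
  exact ⟨fun n => (K (n + 1)).1, antitone_nat_of_succ_le fun n => hF (n + 1) _ (K (n + 1)).2,
    fun n => hP n _ (K n).2⟩

/-- Second countability makes the algebra of clopen sets countable. -/
theorem exists_seq_isClopen_separating (X : Type u) [TopologicalSpace X] [CompactSpace X]
    [T2Space X] [TotallyDisconnectedSpace X] [SecondCountableTopology X] :
    ∃ Q : ℕ → Set X, (∀ n, IsClopen (Q n)) ∧ ∀ x y, (∀ n, x ∈ Q n ↔ y ∈ Q n) → x = y := by
  have := TopologicalSpace.Clopens.countable_iff_secondCountable.2
    (inferInstance : SecondCountableTopology X)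
  obtain ⟨f, hf⟩ := exists_surjective_nat (TopologicalSpace.Clopens X)
  refine ⟨fun n => f n, fun n => (f n).isClopen, fun x y h => ?_⟩
  by_contra hxy
  obtain ⟨U, hU, hx, hy⟩ := compact_exists_isClopen_in_isOpen isOpen_compl_singleton
    (show x ∈ ({y}ᶜ : Set X) from hxy)
  obtain ⟨n, hn⟩ := hf ⟨U, hU⟩
  have : x ∈ (f n : Set X) ↔ y ∈ (f n : Set X) := h n
  rw [hn] at this
  exact hy (this.1 hx) rfl

/-! ### The diagram and the edge labels adapted to a cocycle. -/

section Finite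

variable {X : Type u} [TopologicalSpace X] {R : Setoid X} {𝓔 : Exhaustion R} {A : Type v} [Group A]

/-- The data that a partition at level `n` has to respect: the cocycle and the preceding
relation. -/
noncomputable def levelData (𝓔 : Exhaustion R) (c : Graph R → A) (n : ℕ) (x y : X) : A × Prop :=
  (extendOne c x y, 𝓔.shift (n - 1) x y)

/-- The lift along level n + 1 stays in level n, because `levelData` at n + 1 records membership in
level n. -/
theorem lift_shift {c : Graph R → A} {K : ℕ → Setoid X}
    (hK : ∀ n, IsAdapted (𝓔.shift n) (levelData 𝓔 c n) (K n)) (n : ℕ) (x y x' : X)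
    (hxy : K (n + 1) x y) (hx : 𝓔.shift n x x') : ∃ y', 𝓔.shift n y y' ∧ K (n + 1) x' y' := by
  have hx1 := 𝓔.monotone_shift n.le_succ hx
  obtain ⟨y', hy', hxy'⟩ := (hK (n + 1)).exists_lift x y x' hxy hx1
  have h : 𝓔.shift n x x' = 𝓔.shift n y y' :=
    congrArg Prod.snd ((hK (n + 1)).apply_eq x y x' y' hxy hxy' hx1 hy')
  exact ⟨y', h ▸ hx, hxy'⟩

/-- The types of points for a decreasing sequence of adapted partitions. -/
noncomputable def typeSystem {c : Graph R → A} {K : ℕ → Setoid X} (hanti : Antitone K)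
    (hK : ∀ n, IsAdapted (𝓔.shift n) (levelData 𝓔 c n) (K n))
    (hsep : ∀ x y, (∀ n, K n x y) → x = y) : TypeSystem 𝓔.shift where
  T n := (hK n).type
  E n := joinSetoid (𝓔.shift n) (K (n + 1)) (lift_shift hK n)
  openClasses n := openClasses_joinSetoid _ (hK (n + 1)).openClasses
  le_source n _ _ := fun ⟨x', hx, hy⟩ => ⟨x', hx, hanti n.le_succ hy⟩
  le_range n _ _ := fun ⟨x', hx, hy⟩ => ⟨x', 𝓔.monotone_shift n.le_succ hx, hy⟩
  rel_le n _ y h := ⟨y, h, (K (n + 1)).refl y⟩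
  exists_lift n _ _ := fun ⟨x', hx, hz⟩ => ⟨x', hx, x', (𝓔.shift n).refl x', hz⟩
  eq_of_forall x y h := by
    -- Level 0 is equality, which starts the induction. At later levels the intermediate point x' is
    -- in the same cell and the same class as x, hence equals x.
    have key : ∀ n, K (n + 1) x y := by
      intro n
      induction n with
      | zero =>
        obtain ⟨x', hx, hy⟩ := h 0
        exact (show x = x' from hx) ▸ hy
      | succ n ih =>
        obtain ⟨x', hx, hy⟩ := h (n + 1)
        have : x = x' := (hK (n + 1)).eq_of_rel x x'
          ((K (n + 1)).trans ih ((K (n + 1)).symm (hanti (n + 1).le_succ hy))) hx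
        exact this ▸ hy
    exact hsep x y fun n => hanti n.le_succ (key n)

variable [CompactSpace X] [T2Space X] [SecondCountableTopology X] [TopologicalSpace A]

theorem exists_antitone_isAdapted [T1Space A] (hAF : 𝓔.IsAF) {c : Graph R → A}
    (hc : IsContCocycle 𝓔 c) (hfin : FinitelyValuedOnEach 𝓔 c) :
    ∃ K : ℕ → Setoid X, Antitone K ∧ (∀ n, IsAdapted (𝓔.shift n) (levelData 𝓔 c n) (K n)) ∧
      ∀ x y, (∀ n, K n x y) → x = y := by
  have := hAF.totallyDisconnected
  obtain ⟨Q, hQ, hsep⟩ := exists_seq_isClopen_separating X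
  obtain ⟨K, hK, hKn⟩ := exists_antitone_openClasses
    (P := fun n L => IsAdapted (𝓔.shift n) (levelData 𝓔 c n) L ∧
      ∀ x y, L x y → (x ∈ Q n ↔ y ∈ Q n)) fun n K hK => by
    have hd : LocConstOn (𝓔.shift n) (levelData 𝓔 c n) :=
      (locConstOn_extendOne_shift 𝓔 hc.continuous hfin n).prodMk
        ((𝓔.isEtale_shift hAF n).locConstOn_of_le (𝓔.isEtale_shift hAF (n - 1))
          (𝓔.monotone_shift (Nat.sub_le n 1)))
    obtain ⟨L, hL, hLa⟩ := (𝓔.isEtale_shift hAF n).exists_isAdapted hd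
      (hK.inf (OpenClasses.ker_mem (fun _ : Unit => Q n) fun _ => hQ n))
    exact ⟨L, hL.trans inf_le_left, hLa.openClasses, hLa,
      fun x y hxy => iff_of_eq (congrFun (hL hxy).2 ())⟩
  exact ⟨K, hK, fun n => (hKn n).1, fun x y h => hsep x y fun n => (hKn n).2 x y (h n)⟩

/-- A finitely valued continuous cocycle becomes a quasi-product cocycle. -/
theorem exists_isQuasiProduct [T1Space A] (hAF : 𝓔.IsAF) {c : Graph R → A}
    (hc : IsContCocycle 𝓔 c) (hfin : FinitelyValuedOnEach 𝓔 c) :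
    ∃ (B : BratteliDiagram.{u}) (φ : X ≃ₜ B.Path) (h : Carries R B.tail φ.toEquiv),
      IsTopIso 𝓔 B.tailExhaustion φ h ∧ B.IsQuasiProduct (c ∘ h.graphEquiv.symm) := by
  obtain ⟨K, hanti, hK, hsep⟩ := exists_antitone_isAdapted hAF hc hfin
  let 𝒯 := typeSystem hanti hK hsep
  obtain ⟨h, hiso⟩ := 𝒯.exists_isTopIso 𝓔
  refine ⟨𝒯.diagram, _, h, hiso, fun x y z hxy hyz => hc.cocycle _ _ _ _ _, ?_⟩
  have hbase := fun n => (hK n).exists_basePoint (𝓔.isEtale_shift hAF n).isClosed_graph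
  choose ρ _ hρ hρ_eq hρK using hbase
  have hρR : ∀ n x, R x (ρ n x) := fun n x => 𝓔.rel_of_shift (hρ n x)
  -- Moving inside an `𝓔.shift n`-class changes neither base point, so x and y may be taken in one
  -- cell of `K (n + 1)`. The lift of the base point of x is then that of y by uniqueness, and both
  -- pairs of base points are equivalent for the fine partition `K (n + 1)`, where `c` is constant.
  have hlabel : ∀ n x y, 𝒯.E n x y →
      extendOne c (ρ n x) (ρ (n + 1) x) = extendOne c (ρ n y) (ρ (n + 1) y) := by
    rintro n x y ⟨x', hx, hxy⟩
    have hle : 𝓔.shift n ≤ 𝓔.shift (n + 1) := 𝓔.monotone_shift n.le_succ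
    rw [hρ_eq n x x' hx, hρ_eq (n + 1) x x' (hle hx)]
    obtain ⟨y', hyy', hKy'⟩ := lift_shift hK n x' y (ρ n x') hxy (hρ n x')
    have hy' : y' = ρ n y := by
      refine (hK n).eq_of_rel _ _ ((K n).trans (hanti n.le_succ ((K (n + 1)).symm hKy'))
        (hρK n x' y ⟨x', (𝓔.shift n).refl x', hanti n.le_succ hxy⟩)) ?_
      exact (𝓔.shift n).trans ((𝓔.shift n).symm hyy') (hρ n y)
    subst hy'
    refine congrArg Prod.fst ((hK (n + 1)).apply_eq _ _ _ _ hKy'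
      (hρK (n + 1) x' y ⟨x', (𝓔.shift (n + 1)).refl x', hxy⟩) ?_ ?_)
    · exact (𝓔.shift (n + 1)).trans ((𝓔.shift (n + 1)).symm (hle (hρ n x'))) (hρ (n + 1) x')
    · exact (𝓔.shift (n + 1)).trans ((𝓔.shift (n + 1)).symm (hle (hρ n y))) (hρ (n + 1) y)
  let f : ∀ n, 𝒯.diagram.E n → A := fun n => Quotient.lift _ (hlabel n)
  have hprod : ∀ x n, BratteliDiagram.labelProd f (𝒯.pathOf x) n = extendOne c x (ρ n x) := by
    intro x n
    induction n with
    | zero =>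
      rw [← show x = ρ 0 x from hρ 0 x, hc.cocycle.extendOne_self]
      rfl
    | succ n ih =>
      have h1 : R (ρ n x) (ρ (n + 1) x) := R.trans (R.symm (hρR n x)) (hρR (n + 1) x)
      rw [← hc.cocycle.extendOne_mul (hρR n x) h1, ← ih]
      rfl
  refine ⟨f, fun p => ?_⟩
  obtain ⟨⟨⟨x, y⟩, hxy⟩, rfl⟩ := h.graphEquiv.surjective p
  obtain ⟨N, hN⟩ := (𝓔.union x y).1 hxy
  filter_upwards [eventually_ge_atTop (N + 1)] with n hn
  have hn' : ρ n x = ρ n y := hρ_eq n x y (𝓔.monotone_shift hn hN)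
  have hx := hprod x n
  have hy := hprod y n
  rw [Function.comp_apply, Equiv.symm_apply_apply, ← extendOne_of_rel c hxy,
    ← hc.cocycle.extendOne_mul (hρR n x) (R.trans (R.symm (hρR n x)) hxy)]
  change BratteliDiagram.labelProd f (𝒯.pathOf x) n *
    (BratteliDiagram.labelProd f (𝒯.pathOf y) n)⁻¹ = _
  rw [hx, hy, hc.cocycle.extendOne_inv (hρR n y), hn']

end Finite

/-! ### Reduction to finitely valued cocycles -/

theorem IsContCocycle.conj {X : Type u} [TopologicalSpace X] {R : Setoid X} {𝓔 : Exhaustion R}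
    {A : Type v} [Group A] [TopologicalSpace A] [IsTopologicalGroup A] {c : Graph R → A}
    (hc : IsContCocycle 𝓔 c) {b : X → A} (hb : Continuous b) :
    IsContCocycle 𝓔 fun p => b p.1.1 * c p * (b p.1.2)⁻¹ where
  cocycle x y z hxy hyz := by
    simp only [← hc.cocycle x y z hxy hyz]
    group
  continuous := by
    refine 𝓔.continuous_iff.2 fun n => ?_
    have h := 𝓔.continuous_iff.1 hc.continuous n
    exact ((hb.comp (continuous_fst.comp continuous_subtype_val)).mul h).mul
      (hb.comp (continuous_snd.comp continuous_subtype_val)).inv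

/-- A sequence of continuous maps into a locally compact metric space that is, from the beginning,
sufficiently close to the first one converges to a continuous map. -/
theorem exists_pos_forall_exists_tendsto {X : Type*} [TopologicalSpace X] [CompactSpace X]
    {M : Type*} [MetricSpace M] [LocallyCompactSpace M]
    {b₀ : X → M} (hb₀ : Continuous b₀) :
    ∃ ε > 0, ∀ b : ℕ → X → M, b 0 = b₀ → (∀ n, Continuous (b n)) →
      (∀ n x, dist (b n x) (b (n + 1) x) ≤ ε / 2 / 2 ^ n) →
      ∃ b' : X → M, Continuous b' ∧ ∀ x, Tendsto (fun n => b n x) atTop (𝓝 (b' x)) := by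
  -- The metric need not be complete. The steps ε / 2 / 2 ^ n add up to ε, so the sequence stays in
  -- a compact thickening, where Cauchy sequences converge.
  obtain ⟨ε, hε, hcomp⟩ := (isCompact_range hb₀).exists_isCompact_cthickening
  refine ⟨ε, hε, fun b hb hbc hdist => ?_⟩
  have hmem : ∀ n x, b n x ∈ Metric.cthickening ε (range b₀) := by
    intro n x
    have h : dist (b n x) (b₀ x) ≤ ε - ε / 2 ^ n := by
      induction n with
      | zero => simp [hb]
      | succ n ih =>
        have h1 := dist_triangle (b (n + 1) x) (b n x) (b₀ x)
        have h2 := hdist n x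
        rw [dist_comm] at h2
        have h3 : ε / 2 ^ (n + 1) = ε / 2 / 2 ^ n := by
          rw [pow_succ']
          field_simp
        have h4 : ε / 2 ^ n = ε / 2 / 2 ^ n + ε / 2 / 2 ^ n := by ring
        linarith
    have h' : 0 ≤ ε / 2 ^ n := by positivity
    exact Metric.mem_cthickening_of_dist_le _ (b₀ x) ε _ (mem_range_self x) (by linarith)
  have hlim : ∀ x, ∃ l, Tendsto (fun n => b n x) atTop (𝓝 l) := fun x => by
    obtain ⟨l, -, hl⟩ := cauchySeq_tendsto_of_isComplete hcomp.isComplete (fun n => hmem n x)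
      (cauchySeq_of_le_geometric_two fun n => hdist n x)
    exact ⟨l, hl⟩
  choose b' hb' using hlim
  refine ⟨b', ?_, hb'⟩
  have hunif : TendstoUniformly b b' atTop := by
    rw [Metric.tendstoUniformly_iff]
    intro δ hδ
    have h0 : Tendsto (fun n : ℕ => ε / 2 ^ n) atTop (𝓝 0) := by
      have := (tendsto_pow_atTop_nhds_zero_of_lt_one (r := (1 / 2 : ℝ)) (by norm_num)
        (by norm_num)).const_mul ε
      simpa [div_eq_mul_inv] using this
    filter_upwards [h0.eventually (gt_mem_nhds hδ)] with n hn x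
    rw [dist_comm]
    exact (dist_le_of_le_geometric_two_of_tendsto (fun n => hdist n x) (hb' x) n).trans_lt hn
  exact hunif.continuous (Frequently.of_forall hbc)

/-! ### Coboundaries on each level and their approximation. -/

section Reduction

variable {X : Type u} [TopologicalSpace X] [CompactSpace X] [T2Space X]

/-- Locally constant `R`-invariant choices, when choices near every class of `R` are possible. -/
theorem IsEtale.exists_isLocallyConstant_invariant [TotallyDisconnectedSpace X] {R : Setoid X}
    (hR : IsEtale R) {A : Type v} [Nonempty A] {P : X → A → Prop}
    (h : ∀ x, ∃ a O, IsOpen O ∧ (∀ y, R x y → y ∈ O) ∧ ∀ y ∈ O, P y a) :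
    ∃ k : X → A, IsLocallyConstant k ∧ (∀ x y, R x y → k x = k y) ∧ ∀ y, P y (k y) := by
  have key : ∀ x, ∃ a W, IsClopen W ∧ x ∈ W ∧ (∀ y z, R y z → (y ∈ W ↔ z ∈ W)) ∧
      ∀ y ∈ W, P y a := by
    intro x
    obtain ⟨a, O, hO, hxO, hPO⟩ := h x
    -- The complement of the saturation of `Oᶜ` is the open set of points whose whole class lies in
    -- `O`; the saturation of a clopen `Q` inside it stays inside.
    obtain ⟨Q, hQ, hxQ, hQO⟩ := compact_exists_isClopen_in_isOpen
      (hR.isClosed_saturation hO.isClosed_compl).isOpen_compl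
      (show x ∈ (saturation R Oᶜ)ᶜ from fun ⟨y, hy, hxy⟩ => hy (hxO y hxy))
    refine ⟨a, saturation R Q, hR.isClopen_saturation hQ, ⟨x, hxQ, R.refl x⟩,
      fun y z => saturation_congr, fun y ⟨z, hz, hyz⟩ => hPO y ?_⟩
    by_contra hy
    exact hQO hz ⟨y, hy, R.symm hyz⟩
  choose a W hW hxW hsat hP using key
  obtain ⟨t, -, ht⟩ := isCompact_univ.elim_nhds_subcover W
    fun x _ => (hW x).isOpen.mem_nhds (hxW x)
  -- A choice made from the membership pattern alone is automatically invariant and locally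
  -- constant.
  let m : X → t → Prop := fun x p => x ∈ W p.1
  have hm : IsLocallyConstant m := by
    rw [IsLocallyConstant.iff_exists_open]
    exact fun x => ⟨{y | Setoid.ker m x y}, OpenClasses.ker_mem (fun p : t => W p.1)
      (fun p => hW p.1) x, rfl, fun y hy => Eq.symm hy⟩
  have hm' : ∀ x, ∃ p, m x p := fun x => by
    obtain ⟨p, hp, hx⟩ := mem_iUnion₂.1 (ht (mem_univ x))
    exact ⟨⟨p, hp⟩, hx⟩
  have hF : ∀ s : t → Prop, ∃ b : A, (∃ p, s p) → ∃ p, s p ∧ b = a p.1 := fun s => by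
    by_cases hs : ∃ p, s p
    · obtain ⟨p, hp⟩ := hs
      exact ⟨a p.1, fun _ => ⟨p, hp, rfl⟩⟩
    · exact ⟨Classical.arbitrary A, fun h => absurd h hs⟩
  choose F hF using hF
  refine ⟨F ∘ m, hm.comp F, fun x y hxy => congrArg F ?_, fun y => ?_⟩
  · exact funext fun p => propext (hsat p.1 x y hxy)
  · obtain ⟨p, hp, hFp⟩ := hF (m y) (hm' y)
    rw [Function.comp_apply, hFp]
    exact hP p.1 y hp

variable {R : Setoid X} {𝓔 : Exhaustion R} {A : Type v} [Group A] [TopologicalSpace A]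

/-- On each `R_n`, a continuous cocycle is a coboundary. -/
theorem IsContCocycle.exists_eq_mul_inv {c : Graph R → A} (hc : IsContCocycle 𝓔 c)
    (hAF : 𝓔.IsAF) (n : ℕ) :
    ∃ g : X → A, Continuous g ∧ ∀ x y, 𝓔.rel n x y → extendOne c x y = g x * (g y)⁻¹ := by
  have := hAF.totallyDisconnected
  have hle : ∀ {x y}, 𝓔.rel n x y → R x y := fun h => (𝓔.union _ _).2 ⟨n, h⟩
  have hR := (hAF.proper n).isEtale
  obtain ⟨K, -, hK⟩ := hR.exists_isAdapted (d := fun x y => x = y) hR.locConstOn_eq OpenClasses.top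
  obtain ⟨ρ, hρc, hρ, hρ_eq, -⟩ := hK.exists_basePoint hR.isClosed_graph
  -- Evaluation against the common base point of a class trivializes the cocycle there.
  refine ⟨fun x => extendOne c x (ρ x), ?_, fun x y hxy => ?_⟩
  · have h : Continuous fun x => (⟨(x, ρ x), hρ x⟩ : Graph (𝓔.rel n)) :=
      (continuous_id.prodMk hρc).subtype_mk _
    refine ((𝓔.continuous_iff.1 hc.continuous n).comp h).congr fun x => ?_
    exact (extendOne_of_rel c (hle (hρ x))).symm
  · have hxρ : R x (ρ y) := hρ_eq x y hxy ▸ hle (hρ x)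
    simp only [hc.cocycle.extendOne_inv (hle (hρ y)), hρ_eq x y hxy,
      hc.cocycle.extendOne_mul hxρ (R.symm (hle (hρ y)))]

/-- One step of the approximation of a cocycle by finitely valued ones. -/
theorem IsEtale.exists_isLocallyConstant_dist_le [TotallyDisconnectedSpace X] {S : Setoid X}
    (hS : IsEtale S) {A : Type v} [Group A] [MetricSpace A] [IsTopologicalGroup A]
    {g g' k : X → A} (hg : Continuous g) (hg' : Continuous g')
    (hinv : ∀ x y, S x y → (g x)⁻¹ * g' x = (g y)⁻¹ * g' y) (hk : IsLocallyConstant k)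
    {δ : ℝ} (hδ : 0 < δ) :
    ∃ k' : X → A, IsLocallyConstant k' ∧ (∀ x y, S x y → (k x)⁻¹ * k' x = (k y)⁻¹ * k' y) ∧
      ∀ x, dist (k x * (g x)⁻¹) (k' x * (g' x)⁻¹) ≤ δ := by
  have hkc := hk.continuous
  obtain ⟨u, hu, huS, hdist⟩ := hS.exists_isLocallyConstant_invariant
    (P := fun x a => dist (k x * (g x)⁻¹) (k x * a * (g' x)⁻¹) < δ) fun x => by
    -- With this value the two points coincide along the whole class of x, by `hinv`, so the
    -- distance is small near the class. It is measured on the final products, hence no invariant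
    -- metric is required.
    refine ⟨(g x)⁻¹ * g' x, {y | dist (k y * (g y)⁻¹) (k y * ((g x)⁻¹ * g' x) * (g' y)⁻¹) < δ},
      isOpen_lt (by fun_prop) continuous_const, fun y hxy => ?_, fun y hy => hy⟩
    have : k y * ((g y)⁻¹ * g' y) * (g' y)⁻¹ = k y * (g y)⁻¹ := by group
    change dist _ _ < δ
    rw [hinv x y hxy, this, dist_self]
    exact hδ
  refine ⟨k * u, hk.mul hu, fun x y hxy => ?_, fun x => (hdist x).le⟩
  simp [huS x y hxy]

/-- Invariance of k_n⁻¹ k_{n+1} under R_n freezes k_n(x) k_n(y)⁻¹ on R_N from n = N on, and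
closeness of consecutive k_n g_n⁻¹ yields the continuous conjugating map. -/
theorem IsContCocycle.exists_finitelyValued [IsTopologicalGroup A] [LocallyCompactSpace A]
    [TopologicalSpace.MetrizableSpace A] (hAF : 𝓔.IsAF) {c : Graph R → A}
    (hc : IsContCocycle 𝓔 c) :
    ∃ c' : Graph R → A, IsContCocycle 𝓔 c' ∧ ContCohomologous c c' ∧
      FinitelyValuedOnEach 𝓔 c' := by
  have := hAF.totallyDisconnected
  let := TopologicalSpace.metrizableSpaceMetric A
  choose g hg hcg using hc.exists_eq_mul_inv hAF
  obtain ⟨ε, hε, hlim⟩ := exists_pos_forall_exists_tendsto (hg 0).inv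
  have hinv : ∀ n x y, 𝓔.rel n x y →
      (g n x)⁻¹ * g (n + 1) x = (g n y)⁻¹ * g (n + 1) y := fun n x y hxy => by
    have h := (hcg n x y hxy).symm.trans (hcg (n + 1) x y (𝓔.mono n.le_succ hxy))
    rw [mul_inv_eq_iff_eq_mul] at h
    rw [h]
    group
  have step : ∀ n (k : {k : X → A // IsLocallyConstant k}), ∃ k' : {k : X → A // IsLocallyConstant k},
      (∀ x y, 𝓔.rel n x y → (k.1 x)⁻¹ * k'.1 x = (k.1 y)⁻¹ * k'.1 y) ∧
      ∀ x, dist (k.1 x * (g n x)⁻¹) (k'.1 x * (g (n + 1) x)⁻¹) ≤ ε / 2 / 2 ^ n := fun n k => by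
    obtain ⟨k', hk', h⟩ := (hAF.proper n).isEtale.exists_isLocallyConstant_dist_le (hg n)
      (hg (n + 1)) (hinv n) k.2 (show 0 < ε / 2 / 2 ^ n by positivity)
    exact ⟨⟨k', hk'⟩, h⟩
  choose F hF hdist using step
  let k : ℕ → {k : X → A // IsLocallyConstant k} := fun n => Nat.rec ⟨1, .one⟩ F n
  obtain ⟨b, hb, hblim⟩ := hlim (fun n x => (k n).1 x * (g n x)⁻¹) (by ext x; simp [k])
    (fun n => (k n).2.continuous.mul (hg n).inv) fun n x => hdist n (k n) x
  refine ⟨_, hc.conj hb, ⟨b, hb, fun _ => rfl⟩, fun N => ?_⟩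
  have hfin := (k N).2.range_finite
  refine (hfin.image2 (fun a a' => a * a'⁻¹) hfin).subset ?_
  rintro _ ⟨⟨⟨x, y⟩, hxy⟩, rfl⟩
  refine ⟨(k N).1 x, mem_range_self x, (k N).1 y, mem_range_self y, ?_⟩
  have hconst : ∀ n, N ≤ n → (k n).1 x * ((k n).1 y)⁻¹ = (k N).1 x * ((k N).1 y)⁻¹ := by
    intro n hn
    induction n, hn using Nat.le_induction with
    | base => rfl
    | succ n hn ih =>
      have h : ((k n).1 x)⁻¹ * (k (n + 1)).1 x = ((k n).1 y)⁻¹ * (k (n + 1)).1 y :=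
        hF n (k n) x y (𝓔.mono hn hxy)
      rw [← ih, eq_mul_inv_iff_mul_eq, ← eq_inv_mul_iff_mul_eq.1 h.symm]
      group
  have hR : R x y := (𝓔.union x y).2 ⟨N, hxy⟩
  -- The conjugate of `c` by the limit is the limit of its conjugates by k_n g_n⁻¹, which on `𝓔.rel
  -- N` are constant in n for n ≥ N.
  refine tendsto_nhds_unique ?_
    (((hblim x).mul (tendsto_const_nhds (x := c ⟨(x, y), hR⟩))).mul (hblim y).inv)
  refine tendsto_const_nhds.congr' ?_
  filter_upwards [eventually_ge_atTop N] with n hn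
  rw [← extendOne_of_rel c hR, hcg n x y (𝓔.mono hn hxy), ← hconst n hn]
  group

end Reduction

end AFRel

theorem theorem3p1 {X : Type u} [TopologicalSpace X] [CompactSpace X] [T2Space X]
    [SecondCountableTopology X] (R : Setoid X) (𝓔 : AFRel.Exhaustion R) (hAF : 𝓔.IsAF)
    (A : Type v) [Group A] [TopologicalSpace A] [IsTopologicalGroup A] [T2Space A]
    [LocallyCompactSpace A] :
    -- (1) `(X, R)` is isomorphic to a tail equivalence relation
    (∃ (B : AFRel.BratteliDiagram.{u}) (φ : X ≃ₜ B.Path)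
        (h : AFRel.Carries R B.tail φ.toEquiv),
        AFRel.IsTopIso 𝓔 B.tailExhaustion φ h) ∧
    -- (2) cocycles with finitely many values on each `R_n`
    (∀ c : AFRel.Graph R → A, AFRel.IsContCocycle 𝓔 c → AFRel.FinitelyValuedOnEach 𝓔 c →
      ∃ (B : AFRel.BratteliDiagram.{u}) (φ : X ≃ₜ B.Path)
        (h : AFRel.Carries R B.tail φ.toEquiv),
        AFRel.IsTopIso 𝓔 B.tailExhaustion φ h ∧
          B.IsQuasiProduct (c ∘ h.graphEquiv.symm)) ∧
    -- (3) reduction of an arbitrary continuous cocycle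
    (TopologicalSpace.MetrizableSpace A →
      ∀ c : AFRel.Graph R → A, AFRel.IsContCocycle 𝓔 c →
        ∃ c' : AFRel.Graph R → A, AFRel.IsContCocycle 𝓔 c' ∧
          AFRel.ContCohomologous c c' ∧ AFRel.FinitelyValuedOnEach 𝓔 c') ∧
    -- (4) every continuous cocycle is cohomologous to a quasi-product cocycle
    (TopologicalSpace.MetrizableSpace A →
      ∀ c : AFRel.Graph R → A, AFRel.IsContCocycle 𝓔 c →
        ∃ c' : AFRel.Graph R → A, AFRel.IsContCocycle 𝓔 c' ∧ AFRel.ContCohomologous c c' ∧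
          ∃ (B : AFRel.BratteliDiagram.{u}) (φ : X ≃ₜ B.Path)
            (h : AFRel.Carries R B.tail φ.toEquiv),
            AFRel.IsTopIso 𝓔 B.tailExhaustion φ h ∧
              B.IsQuasiProduct (c' ∘ h.graphEquiv.symm)) := by
  refine ⟨?_, fun c hc hfin => AFRel.exists_isQuasiProduct hAF hc hfin,
    fun _ c hc => hc.exists_finitelyValued hAF, fun _ c hc => ?_⟩
  -- The bare isomorphism is the case of the trivial cocycle.
  · have h1 : AFRel.IsContCocycle 𝓔 fun _ : AFRel.Graph R => (1 : A) :=
      ⟨fun _ _ _ _ _ => one_mul 1, 𝓔.continuous_iff.2 fun _ => continuous_const⟩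
    obtain ⟨B, φ, h, hiso, -⟩ := AFRel.exists_isQuasiProduct hAF h1 fun _ =>
      (Set.finite_singleton (1 : A)).subset (by rintro _ ⟨p, rfl⟩; rfl)
    exact ⟨B, φ, h, hiso⟩
  · obtain ⟨c', hc', hcc', hfin⟩ := hc.exists_finitelyValued hAF
    exact ⟨c', hc', hcc', AFRel.exists_isQuasiProduct hAF hc' hfin⟩
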